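/- Let $k\ge 1$ and let $\mathbf p=(p_1,\dots,p_k)'$ be a probability vector with $p_i>0$ for all $i$ and $\sum_i p_i=1$. For each $n$ let $\mathbf m=\mathbf m^{(n)}=(m_1,\dots,m_k)'$ be a random vector with the multinomial distribution with $n$ trials and cell probabilities $\mathbf p$, let $\hat{\mathbf p}=\mathbf m/n$ be the vector of relative frequencies, and put $$\mathbf x=\sqrt n\,(\hat{\mathbf p}-\mathbf p),\qquad \mathbf y=\mathbf D^{-1/2}(\mathbf p)\,\mathbf x,$$ where $\mathbf D(\mathbf p)$ is the diagonal matrix with diagonal entries $p_i$ and $\mathbf D^{-1/2}(\mathbf p)$ is the diagonal matrix with diagonal entries $1/\sqrt{p_i}$. Let $$\mathbf\Sigma^{*}=\mathbf D^{-1/2}(\mathbf p)\,\bigl(\mathbf D(\mathbf p)-\mathbf p\mathbf p'\bigr)\,\mathbf D^{-1/2}(\mathbf p).$$ Then $\mathbf\Sigma^{*}$ is positive semidefinite, and as $n\to\infty$ the vector $\mathbf y$ converges in distribution to the (possibly degenerate) multivariate normal distribution $\mathcal N(\mathbf 0,\mathbf\Sigma^{*})$ with mean $\mathbf 0$ and variance-covariance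 matrix $\mathbf\Sigma^{*}$. The matrix $\mathbf\Sigma^{*}$ is idempotent, $(\mathbf\Sigma^{*})^2=\mathbf\Sigma^{*}$. Furthermore, the vector $\sqrt{\mathbf p}=(\sqrt{p_1},\dots,\sqrt{p_k})'$ is an eigenvector of $\mathbf\Sigma^{*}$ with eigenvalue $0$, and it spans the kernel of $\mathbf\Sigma^{*}$. -/

import Mathlib

open MeasureTheory ProbabilityTheory Filter

/-- The random vector `m` of cell counts has, under `P`, the multinomial distribution with
`n` trials and cell probabilities `p`: for each `c`, the probability that `m = c` is
`n! / (c₁! ⋯ c_k!) * p₁ ^ c₁ ⋯ p_k ^ c_k` if `c₁ + ⋯ + c_k = n`, and `0` otherwise. -/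
structure IsMultinomial {k : ℕ} {Ω : Type*} [MeasurableSpace Ω] (n : ℕ) (p : Fin k → ℝ)
    (m : Ω → Fin k → ℕ) (P : Measure Ω) : Prop where
  aemeasurable : AEMeasurable m P
  prob_eq : ∀ c : Fin k → ℕ, P.real {ω | m ω = c} =
    if ∑ i, c i = n then (Nat.multinomial Finset.univ c : ℝ) * ∏ i, p i ^ c i else 0

/-- The vector of relative frequencies `p̂ = m / n`. -/
noncomputable def relFreq {k : ℕ} (n : ℕ) (c : Fin k → ℕ) : Fin k → ℝ :=
  fun i => (c i : ℝ) / (n : ℝ)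

/-- The normalized frequency vector `x = √n (p̂ - p)`. -/
noncomputable def normalizedFreq {k : ℕ} (n : ℕ) (p : Fin k → ℝ) (c : Fin k → ℕ) : Fin k → ℝ :=
  Real.sqrt (n : ℝ) • (relFreq n c - p)

/-- The vector `√p`. -/
noncomputable def sqrtVec {k : ℕ} (p : Fin k → ℝ) : Fin k → ℝ :=
  fun i => Real.sqrt (p i)

/-- The diagonal matrix `D^{-1/2}(p)` with diagonal entries `1 / √(p i)`. -/
noncomputable def invSqrtDiag {k : ℕ} (p : Fin k → ℝ) : Matrix (Fin k) (Fin k) ℝ :=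
  Matrix.diagonal fun i => (Real.sqrt (p i))⁻¹

/-- The rescaled vector `y = D^{-1/2}(p) x`, as an element of Euclidean space. -/
noncomputable def rescaledFreq {k : ℕ} (n : ℕ) (p : Fin k → ℝ) (c : Fin k → ℕ) :
    EuclideanSpace ℝ (Fin k) :=
  WithLp.toLp 2 ((invSqrtDiag p).mulVec (normalizedFreq n p c))

/-- The matrix `Σ = D(p) - p p'`. -/
noncomputable def multinomialCov {k : ℕ} (p : Fin k → ℝ) : Matrix (Fin k) (Fin k) ℝ :=
  Matrix.diagonal p - Matrix.vecMulVec p p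

/-- The matrix `Σ* = D^{-1/2}(p) Σ D^{-1/2}(p)`. -/
noncomputable def rescaledCov {k : ℕ} (p : Fin k → ℝ) : Matrix (Fin k) (Fin k) ℝ :=
  invSqrtDiag p * multinomialCov p * invSqrtDiag p

open scoped RealInnerProductSpace Topology

section Covariance

variable {k : ℕ} {p : Fin k → ℝ}

/-! Since `√p` is a unit vector, `Σ* = 1 - √p √p'` is the orthogonal projection onto its complement;
the algebraic claims all follow from this. For the limit, convergence of characteristic functions
suffices. The multinomial generating function `(∑ pᵢ zᵢ) ^ n` (`IsMultinomial.integral_prod_pow`)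
shows that the characteristic function of `y` at `t` is exactly the `n`-th power of that of a
variable taking the value `bᵢ = tᵢ / √pᵢ - ⟨√p, t⟩` with probability `pᵢ`, evaluated at `1 / √n`.
This variable has mean `0` and variance `t' Σ* t`, so a second-order expansion
(`tendsto_sum_mul_exp_pow`) gives the Gaussian limit. -/

lemma sqrtVec_dotProduct_self (hp_pos : ∀ i, 0 < p i) (hp_sum : ∑ i, p i = 1) :
    sqrtVec p ⬝ᵥ sqrtVec p = 1 := by
  simp [dotProduct, sqrtVec, Real.mul_self_sqrt (hp_pos _).le, hp_sum]

lemma rescaledCov_eq_one_sub_vecMulVec (hp_pos : ∀ i, 0 < p i) :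
    rescaledCov p = 1 - Matrix.vecMulVec (sqrtVec p) (sqrtVec p) := by
  ext i j
  have hi := Real.sq_sqrt (hp_pos i).le
  have hj := Real.sq_sqrt (hp_pos j).le
  have hi' := (Real.sqrt_pos.2 (hp_pos i)).ne'
  have hj' := (Real.sqrt_pos.2 (hp_pos j)).ne'
  have hpi (i : Fin k) : (√(p i))⁻¹ * p i = √(p i) := by
    rw [inv_mul_eq_div, Real.div_sqrt]
  simp only [rescaledCov, invSqrtDiag, multinomialCov, Matrix.mul_diagonal, Matrix.diagonal_mul,
    Matrix.sub_apply, Matrix.vecMulVec_apply, sqrtVec, mul_sub, sub_mul]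
  congr 1
  · rcases eq_or_ne i j with rfl | hij
    · simp [hpi, hi']
    · simp [hij]
  · rw [← mul_assoc, hpi, mul_assoc, mul_comm (p j), hpi]

lemma rescaledCov_mulVec (hp_pos : ∀ i, 0 < p i) (x : Fin k → ℝ) :
    (rescaledCov p).mulVec x = x - (sqrtVec p ⬝ᵥ x) • sqrtVec p := by
  rw [rescaledCov_eq_one_sub_vecMulVec hp_pos, Matrix.sub_mulVec, Matrix.one_mulVec,
    Matrix.vecMulVec_mulVec]
  ext i
  simp

lemma isIdempotentElem_rescaledCov (hp_pos : ∀ i, 0 < p i) (hp_sum : ∑ i, p i = 1) :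
    IsIdempotentElem (rescaledCov p) := by
  rw [rescaledCov_eq_one_sub_vecMulVec hp_pos]
  refine IsIdempotentElem.one_sub ?_
  rw [IsIdempotentElem, Matrix.vecMulVec_mul_vecMulVec, sqrtVec_dotProduct_self hp_pos hp_sum,
    one_smul]

lemma isHermitian_rescaledCov (hp_pos : ∀ i, 0 < p i) : (rescaledCov p).IsHermitian := by
  rw [rescaledCov_eq_one_sub_vecMulVec hp_pos]
  ext i j
  simp [Matrix.vecMulVec_apply, Matrix.one_apply, eq_comm, mul_comm]

lemma posSemidef_rescaledCov (hp_pos : ∀ i, 0 < p i) (hp_sum : ∑ i, p i = 1) :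
    (rescaledCov p).PosSemidef := by
  -- A symmetric idempotent `S` equals `Sᴴ * S`.
  have h := Matrix.posSemidef_conjTranspose_mul_self (rescaledCov p)
  rwa [(isHermitian_rescaledCov hp_pos).eq,
    (isIdempotentElem_rescaledCov hp_pos hp_sum).eq] at h

lemma rescaledCov_mulVec_sqrtVec (hp_pos : ∀ i, 0 < p i) (hp_sum : ∑ i, p i = 1) :
    (rescaledCov p).mulVec (sqrtVec p) = 0 := by
  rw [rescaledCov_mulVec hp_pos, sqrtVec_dotProduct_self hp_pos hp_sum, one_smul, sub_self]

lemma sqrtVec_ne_zero (hp_pos : ∀ i, 0 < p i) (hp_sum : ∑ i, p i = 1) : sqrtVec p ≠ 0 := by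
  intro h
  simpa [h] using sqrtVec_dotProduct_self hp_pos hp_sum

lemma hasEigenvector_rescaledCov (hp_pos : ∀ i, 0 < p i) (hp_sum : ∑ i, p i = 1) :
    Module.End.HasEigenvector (Matrix.toLin' (rescaledCov p)) 0 (sqrtVec p) := by
  rw [Module.End.hasEigenvector_iff, Module.End.mem_eigenspace_iff]
  exact ⟨by simp [rescaledCov_mulVec_sqrtVec hp_pos hp_sum], sqrtVec_ne_zero hp_pos hp_sum⟩

lemma ker_rescaledCov (hp_pos : ∀ i, 0 < p i) (hp_sum : ∑ i, p i = 1) :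
    LinearMap.ker (Matrix.toLin' (rescaledCov p)) = Submodule.span ℝ {sqrtVec p} := by
  ext x
  rw [LinearMap.mem_ker, Matrix.toLin'_apply, Submodule.mem_span_singleton]
  constructor
  · intro h
    rw [rescaledCov_mulVec hp_pos, sub_eq_zero] at h
    exact ⟨_, h.symm⟩
  · rintro ⟨a, rfl⟩
    rw [Matrix.mulVec_smul, rescaledCov_mulVec_sqrtVec hp_pos hp_sum, smul_zero]

lemma dotProduct_rescaledCov_mulVec (hp_pos : ∀ i, 0 < p i) (x : Fin k → ℝ) :
    x ⬝ᵥ (rescaledCov p).mulVec x = x ⬝ᵥ x - (sqrtVec p ⬝ᵥ x) ^ 2 := by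
  rw [rescaledCov_mulVec hp_pos, dotProduct_sub, dotProduct_smul, dotProduct_comm x (sqrtVec p),
    smul_eq_mul, sq]

end Covariance

section Multinomial

variable {k n : ℕ} {p : Fin k → ℝ} {Ω : Type*} [MeasurableSpace Ω] {P : Measure Ω}
  {m : Ω → Fin k → ℕ}

/-- The expectation of a bounded function of a multinomial vector is a finite sum over the
possible values of the vector. -/
lemma IsMultinomial.integral_comp [IsFiniteMeasure P] (hm : IsMultinomial n p m P)
    {f : (Fin k → ℕ) → ℂ} {C : ℝ} (hf : ∀ c, ‖f c‖ ≤ C) :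
    ∫ ω, f (m ω) ∂P = ∑ c ∈ Finset.piAntidiag Finset.univ n,
      (Nat.multinomial Finset.univ c * ∏ i, (p i : ℂ) ^ c i) * f c := by
  have hfm : Measurable f := measurable_of_countable f
  have hint : Integrable f (P.map m) :=
    .of_bound hfm.aestronglyMeasurable C (.of_forall hf)
  have hreal (c : Fin k → ℕ) : (P.map m).real {c} =
      if ∑ i, c i = n then (Nat.multinomial Finset.univ c : ℝ) * ∏ i, p i ^ c i else 0 := by
    rw [← hm.prob_eq c, map_measureReal_apply_of_aemeasurable hm.aemeasurable
      (measurableSet_singleton c)]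
    rfl
  rw [← integral_map hm.aemeasurable hfm.aestronglyMeasurable, integral_countable hint,
    tsum_eq_sum (s := Finset.piAntidiag Finset.univ n)]
  · refine Finset.sum_congr rfl fun c hc ↦ ?_
    rw [hreal, if_pos (by simpa using hc)]
    simp
  · intro c hc
    rw [hreal, if_neg (by simpa using hc), zero_smul]

/-- The generating function of the multinomial distribution on the unit torus. -/
lemma IsMultinomial.integral_prod_pow [IsFiniteMeasure P] (hm : IsMultinomial n p m P)
    {z : Fin k → ℂ} (hz : ∀ i, ‖z i‖ ≤ 1) :
    ∫ ω, ∏ i, z i ^ m ω i ∂P = (∑ i, p i * z i) ^ n := by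
  rw [hm.integral_comp (f := fun c ↦ ∏ i, z i ^ c i) (C := 1), Finset.sum_pow_eq_sum_piAntidiag]
  · refine Finset.sum_congr rfl fun c _ ↦ ?_
    simp_rw [mul_pow, Finset.prod_mul_distrib, mul_assoc]
  · intro c
    rw [norm_prod]
    refine Finset.prod_le_one (fun i _ ↦ norm_nonneg _) fun i _ ↦ ?_
    rw [norm_pow]
    exact pow_le_one₀ (norm_nonneg _) (hz i)

/-- The excluded count vectors are countably many null events. This makes `inner_rescaledFreq`
applicable almost surely. -/
lemma IsMultinomial.ae_sum_eq (hm : IsMultinomial n p m P) [IsFiniteMeasure P] :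
    ∀ᵐ ω ∂P, ∑ i, m ω i = n := by
  have h : ∀ᵐ ω ∂P, ∀ c : Fin k → ℕ, ∑ i, c i ≠ n → m ω ≠ c := by
    refine ae_all_iff.2 fun c ↦ ?_
    by_cases hc : ∑ i, c i = n
    · simp [hc]
    · have h0 := hm.prob_eq c
      rw [if_neg hc, measureReal_eq_zero_iff] at h0
      simpa [hc, ae_iff] using h0
  filter_upwards [h] with ω hω
  by_contra hne
  exact hω _ hne rfl

/-- The inner product of the rescaled frequency vector with `t` is a linear function of the cell
counts, centred with respect to `p`. -/
lemma inner_rescaledFreq {c : Fin k → ℕ}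
    (hc : ∑ i, c i = n) (t : EuclideanSpace ℝ (Fin k)) :
    ⟪rescaledFreq n p c, t⟫ =
      ∑ i, c i * ((√(n : ℝ))⁻¹ * (t i / √(p i) - sqrtVec p ⬝ᵥ t)) := by
  have hn : √(n : ℝ) * (n : ℝ)⁻¹ = (√(n : ℝ))⁻¹ := by
    rw [← div_eq_mul_inv, Real.sqrt_div_self]
  -- Together with `∑ c i = n`, this spreads the constant `√n ⟨√p, t⟩` over the counts. The case `n
  -- = 0` is covered because `0⁻¹ = 0`.
  have hn' : √(n : ℝ) = n * (√(n : ℝ))⁻¹ := by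
    rw [← div_eq_mul_inv, Real.div_sqrt]
  have hc' : ∑ i, (c i : ℝ) = n := by exact_mod_cast hc
  have hpi (i : Fin k) : p i * (√(p i))⁻¹ = √(p i) := by
    rw [← div_eq_mul_inv, Real.div_sqrt]
  have hterm (i : Fin k) : (√(p i))⁻¹ * (√(n : ℝ) * ((c i : ℝ) / n - p i)) * t i =
      c i * ((√(n : ℝ))⁻¹ * (t i / √(p i))) - √(n : ℝ) * (√(p i) * t i) := by
    linear_combination ((√(p i))⁻¹ * c i * t i) * hn - √(n : ℝ) * t i * hpi i
  have hl : ⟪rescaledFreq n p c, t⟫ =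
      ∑ i, (√(p i))⁻¹ * (√(n : ℝ) * ((c i : ℝ) / n - p i)) * t i := by
    simp [rescaledFreq, invSqrtDiag, normalizedFreq, relFreq, PiLp.inner_apply,
      Matrix.mulVec_diagonal, mul_comm]
  rw [hl, Finset.sum_congr rfl fun i _ ↦ hterm i]
  simp_rw [mul_sub]
  rw [Finset.sum_sub_distrib, Finset.sum_sub_distrib, ← Finset.mul_sum, ← Finset.sum_mul, hc',
    ← mul_assoc, ← hn']
  rfl

lemma aemeasurable_rescaledFreq (hm : AEMeasurable m P) :
    AEMeasurable (fun ω ↦ rescaledFreq n p (m ω)) P :=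
  (measurable_of_countable (rescaledFreq n p)).comp_aemeasurable hm

lemma IsMultinomial.charFun_rescaledFreq [IsFiniteMeasure P] (hm : IsMultinomial n p m P)
    (t : EuclideanSpace ℝ (Fin k)) :
    charFun (P.map fun ω ↦ rescaledFreq n p (m ω)) t =
      (∑ i, p i * Complex.exp
        (((√(n : ℝ))⁻¹ * (t i / √(p i) - sqrtVec p ⬝ᵥ t) : ℝ) * Complex.I)) ^ n := by
  -- The generating function is taken at `zᵢ = exp (i bᵢ / √n)`, on the unit circle.
  rw [charFun_apply, integral_map (aemeasurable_rescaledFreq hm.aemeasurable)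
    (Measurable.aestronglyMeasurable (by fun_prop)), ← hm.integral_prod_pow]
  · refine integral_congr_ae ?_
    filter_upwards [hm.ae_sum_eq] with ω hω
    simp_rw [inner_rescaledFreq hω, ← Complex.exp_nat_mul, ← Complex.exp_sum]
    push_cast
    rw [Finset.sum_mul]
    simp_rw [mul_assoc]
  · intro i
    rw [Complex.norm_exp_ofReal_mul_I]

end Multinomial

section Limit

lemma isLittleO_exp_inv_sqrt_mul_sub_quadratic (b : ℝ) :
    (fun n : ℕ ↦ Complex.exp (((√(n : ℝ))⁻¹ * b : ℝ) * Complex.I) -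
      (1 + ((√(n : ℝ))⁻¹ * b : ℝ) * Complex.I - (b ^ 2 / 2 : ℝ) * (1 / n : ℂ)))
      =o[atTop] fun n : ℕ ↦ (1 / n : ℂ) := by
  have hz : Tendsto (fun n : ℕ ↦ (((√(n : ℝ))⁻¹ * b : ℝ) : ℂ) * Complex.I) atTop (𝓝 0) := by
    have h : Tendsto (fun n : ℕ ↦ (√(n : ℝ))⁻¹ * b) atTop (𝓝 0) := by
      simpa using (tendsto_inv_atTop_zero.comp
        (Real.tendsto_sqrt_atTop.comp tendsto_natCast_atTop_atTop)).mul_const b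
    simpa using ((Complex.continuous_ofReal.tendsto 0).comp h).mul_const Complex.I
  have hsq (n : ℕ) : ((((√(n : ℝ))⁻¹ * b : ℝ) : ℂ) * Complex.I) ^ 2 =
      -(b : ℂ) ^ 2 * (1 / n : ℂ) := by
    have h : ((√(n : ℝ))⁻¹ * b) ^ 2 = b ^ 2 * (1 / n) := by
      rw [mul_pow, inv_pow, Real.sq_sqrt n.cast_nonneg]
      ring
    rw [mul_pow, Complex.I_sq, ← Complex.ofReal_pow, h]
    push_cast
    ring
  -- For `z = i b / √n` the Taylor remainder is `o(z²)`, and `z² = -b² / n` is `O(1 / n)`, even when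
  -- `b = 0`.
  have h := (Complex.exp_sub_sum_range_succ_isLittleO_pow 2).comp_tendsto hz
  refine (h.trans_isBigO ?_).congr_left fun n ↦ ?_
  · exact (Asymptotics.isBigO_const_mul_self (-(b : ℂ) ^ 2) _ _).congr_left fun n ↦ (hsq n).symm
  · simp only [Function.comp_apply, Finset.sum_range_succ, Finset.sum_range_zero, hsq]
    simp [Nat.factorial]
    ring

/-- The `n`-th power of the characteristic function at `(√n)⁻¹` of a centred random variable with
finitely many values converges to the Gaussian characteristic function. -/
lemma tendsto_sum_mul_exp_pow {ι : Type*} [Fintype ι] {p b : ι → ℝ} (hp : ∑ i, p i = 1)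
    (hb : ∑ i, p i * b i = 0) :
    Tendsto (fun n : ℕ ↦ (∑ i, (p i : ℂ) * Complex.exp (((√(n : ℝ))⁻¹ * b i : ℝ) * Complex.I)) ^ n)
      atTop (𝓝 (Complex.exp (-(∑ i, p i * b i ^ 2 : ℝ) / 2))) := by
  apply Complex.tendsto_pow_exp_of_isLittleO_sub_add_div
  have h := Asymptotics.IsLittleO.sum (s := Finset.univ) fun i (_ : i ∈ Finset.univ) ↦
    (isLittleO_exp_inv_sqrt_mul_sub_quadratic (b i)).const_mul_left (p i : ℂ)
  refine h.congr_left fun n ↦ ?_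
  have hp' : ∑ i, (p i : ℂ) = 1 := by exact_mod_cast hp
  have hb' : ∑ i, (p i : ℂ) * b i = 0 := by exact_mod_cast hb
  -- Centring removes the term of order `1 / √n`, which would otherwise dominate.
  have hlin : ∑ i, (p i : ℂ) * (((√(n : ℝ))⁻¹ * b i : ℝ) * Complex.I) = 0 := by
    rw [← zero_mul (((√(n : ℝ))⁻¹ : ℝ) * Complex.I), ← hb', Finset.sum_mul]
    refine Finset.sum_congr rfl fun i _ ↦ ?_
    push_cast
    ring
  have hquad : ∑ i, (p i : ℂ) * ((b i ^ 2 / 2 : ℝ) * (1 / n : ℂ)) =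
      (∑ i, p i * b i ^ 2 : ℝ) / 2 / n := by
    push_cast
    simp_rw [Finset.sum_div]
    refine Finset.sum_congr rfl fun i _ ↦ ?_
    ring
  simp_rw [Finset.sum_apply, mul_sub, mul_add, mul_one]
  rw [Finset.sum_sub_distrib, Finset.sum_sub_distrib, Finset.sum_add_distrib, hlin, hquad, hp']
  ring

lemma tendstoInDistribution_rescaledFreq {k : ℕ} {p : Fin k → ℝ} (hp_pos : ∀ i, 0 < p i)
    (hp_sum : ∑ i, p i = 1) {Ω : ℕ → Type*} [∀ n, MeasurableSpace (Ω n)]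
    (P : (n : ℕ) → Measure (Ω n)) [∀ n, IsProbabilityMeasure (P n)]
    {m : (n : ℕ) → Ω n → Fin k → ℕ} (hm : ∀ n, IsMultinomial n p (m n) (P n)) :
    TendstoInDistribution (fun n ω => rescaledFreq n p (m n ω)) atTop
      (id : EuclideanSpace ℝ (Fin k) → EuclideanSpace ℝ (Fin k)) P
      (multivariateGaussian 0 (rescaledCov p)) where
  forall_aemeasurable n := aemeasurable_rescaledFreq (hm n).aemeasurable
  tendsto := by
    refine ProbabilityMeasure.tendsto_iff_tendsto_charFun.2 fun t ↦ ?_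
    have hsq (i : Fin k) : p i = √(p i) ^ 2 := (Real.sq_sqrt (hp_pos i).le).symm
    have hne (i : Fin k) : √(p i) ≠ 0 := (Real.sqrt_pos.2 (hp_pos i)).ne'
    have hlin (i : Fin k) : p i * (t i / √(p i)) = sqrtVec p i * t i := by
      rw [← mul_div_assoc, mul_div_right_comm, Real.div_sqrt, sqrtVec]
    have hquad (i : Fin k) : p i * (t i / √(p i)) ^ 2 = t i * t i := by
      rw [div_pow, Real.sq_sqrt (hp_pos i).le, mul_div_cancel₀ _ (hp_pos i).ne', sq]
    have hmean : ∑ i, p i * (t i / √(p i) - sqrtVec p ⬝ᵥ t) = 0 := by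
      simp_rw [mul_sub, hlin]
      rw [Finset.sum_sub_distrib, ← Finset.sum_mul, hp_sum, one_mul]
      exact sub_self _
    -- Variance as second moment `t ⬝ᵥ t` minus squared mean: the quadratic form of the projection.
    have hvar : ∑ i, p i * (t i / √(p i) - sqrtVec p ⬝ᵥ t) ^ 2 =
        t ⬝ᵥ (rescaledCov p).mulVec t := by
      have hterm (i : Fin k) : p i * (t i / √(p i) - sqrtVec p ⬝ᵥ t) ^ 2 =
          t i * t i - 2 * (sqrtVec p ⬝ᵥ t) * (sqrtVec p i * t i) +
            p i * (sqrtVec p ⬝ᵥ t) ^ 2 := by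
        rw [← hquad, ← hlin]
        ring
      rw [Finset.sum_congr rfl fun i _ ↦ hterm i, Finset.sum_add_distrib, Finset.sum_sub_distrib,
        ← Finset.mul_sum, ← Finset.sum_mul, hp_sum, dotProduct_rescaledCov_mulVec hp_pos]
      change t ⬝ᵥ t - 2 * (sqrtVec p ⬝ᵥ t) * (sqrtVec p ⬝ᵥ t) + _ = _
      ring
    have h := tendsto_sum_mul_exp_pow hp_sum hmean
    rw [hvar] at h
    simpa [(hm _).charFun_rescaledFreq,
      charFun_multivariateGaussian (posSemidef_rescaledCov hp_pos hp_sum), neg_div] using h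

end Limit

theorem theoremT {k : ℕ} (p : Fin k → ℝ) (hp_pos : ∀ i, 0 < p i) (hp_sum : ∑ i, p i = 1)
    {Ω : ℕ → Type*} [∀ n, MeasurableSpace (Ω n)]
    (P : (n : ℕ) → Measure (Ω n)) [∀ n, IsProbabilityMeasure (P n)]
    (m : (n : ℕ) → Ω n → Fin k → ℕ) (hm : ∀ n, IsMultinomial n p (m n) (P n)) :
    TendstoInDistribution (fun n ω => rescaledFreq n p (m n ω)) atTop
        (id : EuclideanSpace ℝ (Fin k) → EuclideanSpace ℝ (Fin k)) P
        (multivariateGaussian 0 (rescaledCov p)) ∧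
      (rescaledCov p).PosSemidef ∧
      (∀ i j, cov[fun y : EuclideanSpace ℝ (Fin k) => y i, fun y => y j;
        multivariateGaussian 0 (rescaledCov p)] = rescaledCov p i j) ∧
      IsIdempotentElem (rescaledCov p) ∧
      Module.End.HasEigenvector (Matrix.toLin' (rescaledCov p)) 0 (sqrtVec p) ∧
      LinearMap.ker (Matrix.toLin' (rescaledCov p)) = Submodule.span ℝ {sqrtVec p} := by
  exact ⟨tendstoInDistribution_rescaledFreq hp_pos hp_sum P hm,
    posSemidef_rescaledCov hp_pos hp_sum,
    fun i j ↦ covariance_eval_multivariateGaussian (posSemidef_rescaledCov hp_pos hp_sum) i j,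
    isIdempotentElem_rescaledCov hp_pos hp_sum,
    hasEigenvector_rescaledCov hp_pos hp_sum, ker_rescaledCov hp_pos hp_sum⟩
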